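/- Let $f\in\,]0,1[$. Consider the infinite group problem: find $s=(s_r)_{r\in[0,1[}$ with finite support, $s_r\in\mathbb{Z}_{\ge 0}$, and $\sum_{r\in[0,1[} r\,s_r = f$ modulo $1$. A function $\pi:[0,1[\,\to\mathbb{R}$ is *valid* if $\pi\ge 0$, $\pi(0)=0$, and $\sum_{r}\pi(r)s_r\ge 1$ for every solution $s$; let $P(\pi)$ be the set of solutions $s$ with $\sum_r\pi(r)s_r=1$. A valid function $\pi$ is a *facet* if for every valid function $\pi^*$, $P(\pi^*)\supseteq P(\pi)$ implies $\pi^*=\pi$. Let $0<\alpha<1$ and let $(\epsilon_i)_{i\ge1}$ be a nonincreasing sequence of positive real numbers with $\epsilon_1\le 1-\alpha$ and $\sum_{i=1}^{\infty}2^{i-1}\epsilon_i<\alpha$. Define $\psi_i:[0,1[\,\to\mathbb{R}$, $i\ge 0$, recursively. Put $\psi_0(x)=x/\alpha$ for $0\le x\le\alpha$ and $\psi_0(x)=(1-x)/(1-\alpha)$ for $\alpha\le x<1$. The function $\psi_{i+1}$ is obtained from $\psi_i$ by replacing, for every maximal (with respect to inclusion) interval $[a,b]\subseteq[0,\alpha]$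 on which $\psi_i$ has constant positive slope, the graph of $\psi_i$ over $[a,b]$ by the three segments that join consecutively the points $$(a,\psi_i(a)),\quad \Bigl(\tfrac{a+b-\epsilon_{i+1}}{2},\,\psi_i(\tfrac{a+b}{2})+\tfrac{\epsilon_{i+1}}{2(1-\alpha)}\Bigr),\quad \Bigl(\tfrac{a+b+\epsilon_{i+1}}{2},\,\psi_i(\tfrac{a+b}{2})-\tfrac{\epsilon_{i+1}}{2(1-\alpha)}\Bigr),\quad (b,\psi_i(b)),$$ and leaving $\psi_i$ unchanged elsewhere. **Theorem.** For every $i\ge 0$, the function $\psi_i$ is a facet of the infinite group problem with right-hand side $f=\alpha$. -/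

import Mathlib

/-- The interval `[0,1[`, which indexes the variables of the infinite group problem. -/
abbrev UnitIco : Type := Set.Ico (0 : ℝ) 1

/-- `s` is a solution of the infinite group problem with right-hand side `f`: a finitely
supported vector of nonnegative integers indexed by `[0,1[` with `∑ r s_r = f` modulo 1. -/
def IsSolution (f : ℝ) (s : UnitIco →₀ ℕ) : Prop :=
  ∃ k : ℤ, (s.sum fun r n => (n : ℝ) * (r : ℝ)) = f + k

/-- The left-hand side `∑ π(r) s_r` of the inequality defined by `π`. -/
noncomputable def lhs (π : UnitIco → ℝ) (s : UnitIco →₀ ℕ) : ℝ :=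
  s.sum fun r n => π r * (n : ℝ)

/-- Valid functions for the infinite group problem. -/
structure IsValid (f : ℝ) (π : UnitIco → ℝ) : Prop where
  nonneg : ∀ r, 0 ≤ π r
  map_zero : π ⟨0, le_refl 0, one_pos⟩ = 0
  one_le : ∀ s, IsSolution f s → 1 ≤ lhs π s

/-- `P(π)`: the solutions that satisfy the inequality defined by `π` at equality. -/
def tightSolutions (f : ℝ) (π : UnitIco → ℝ) : Set (UnitIco →₀ ℕ) :=
  {s | IsSolution f s ∧ lhs π s = 1}

/-- Facets: valid functions `π` such that `P(π') ⊇ P(π)` with `π'` valid implies `π' = π`. -/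
def IsFacet (f : ℝ) (π : UnitIco → ℝ) : Prop :=
  IsValid f π ∧
    ∀ π' : UnitIco → ℝ, IsValid f π' → tightSolutions f π ⊆ tightSolutions f π' → π' = π

/-- `g` has constant positive slope on the nondegenerate interval `[a,b]`. -/
def HasConstPosSlope (g : ℝ → ℝ) (a b : ℝ) : Prop :=
  a < b ∧ ∃ m : ℝ, 0 < m ∧ ∀ x ∈ Set.Icc a b, g x = g a + m * (x - a)

/-- `[a,b]` is a maximal (with respect to inclusion) interval contained in `[0,α]` on which `g`
has constant positive slope. -/
def IsMaxPosSlope (α : ℝ) (g : ℝ → ℝ) (a b : ℝ) : Prop :=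
  0 ≤ a ∧ b ≤ α ∧ HasConstPosSlope g a b ∧
    ∀ a' b' : ℝ, 0 ≤ a' → b' ≤ α → HasConstPosSlope g a' b' → a' ≤ a → b ≤ b' →
      a' = a ∧ b' = b

/-- The value at `x` of the line through `(x₁,y₁)` and `(x₂,y₂)`. -/
noncomputable def segmentThrough (x₁ y₁ x₂ y₂ x : ℝ) : ℝ :=
  y₁ + (y₂ - y₁) / (x₂ - x₁) * (x - x₁)

/-- The three segments that replace the graph of `g` over `[a,b]`, evaluated at `x ∈ [a,b]`. -/
noncomputable def threeSegments (α e : ℝ) (g : ℝ → ℝ) (a b x : ℝ) : ℝ :=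
  if x ≤ ((a + b) - e) / 2 then
    segmentThrough a (g a)
      (((a + b) - e) / 2) (g ((a + b) / 2) + e / (2 * (1 - α))) x
  else if x ≤ ((a + b) + e) / 2 then
    segmentThrough (((a + b) - e) / 2) (g ((a + b) / 2) + e / (2 * (1 - α)))
      (((a + b) + e) / 2) (g ((a + b) / 2) - e / (2 * (1 - α))) x
  else
    segmentThrough (((a + b) + e) / 2) (g ((a + b) / 2) - e / (2 * (1 - α)))
      b (g b) x

open Classical in
/-- One step of the construction: over every maximal interval `[a,b] ⊆ [0,α]` on which `g` has
constant positive slope, the graph of `g` is replaced by the three segments; elsewhere `g` is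
unchanged. The chosen pair is the maximal interval that contains `x`. (Two distinct maximal
intervals share at most an endpoint, where both prescribe the value of `g`.) -/
noncomputable def refineStep (α e : ℝ) (g : ℝ → ℝ) (x : ℝ) : ℝ :=
  if h : ∃ p : ℝ × ℝ, IsMaxPosSlope α g p.1 p.2 ∧ x ∈ Set.Icc p.1 p.2 then
    threeSegments α e g h.choose.1 h.choose.2 x
  else g x

/-- The functions `ψ_i`, given by formulas on `ℝ` of which only the restriction to `[0,1[`
matters. The entry `ε 0` is not used. -/
noncomputable def psiReal (α : ℝ) (ε : ℕ → ℝ) : ℕ → ℝ → ℝ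
  | 0 => fun x => if x ≤ α then (1 / α) * x else (1 - x) / (1 - α)
  | i + 1 => refineStep α (ε (i + 1)) (psiReal α ε i)

/-- The function `ψ_i : [0,1[ → ℝ`. -/
noncomputable def psi (α : ℝ) (ε : ℕ → ℝ) (i : ℕ) : UnitIco → ℝ :=
  fun r => psiReal α ε i (r : ℝ)

/-! Write `ψ_i(x) = (C_i(x) - x) / (1 - α)`. Every descending segment of `ψ_i` has slope `-1/(1-α)`,
so `C_i` is constant there. Thus `C_i` is the `i`-th approximation of a Cantor function: it climbs
linearly from `k/2^i` to `(k+1)/2^i` on the interval `[a_k, a_k + l]`, where `a_k = leftEnd α ε i k`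
and `l = pieceLength α ε i`, and it is flat on the gaps between these intervals. One step of the
construction cuts a gap of length `ε (i+1)` out of the middle of each interval
(`psiReal_hasCantorShape`).

Validity rests on the superadditivity `a_j + a_k ≤ a_{j+k}`, with the `a_k` extended periodically
(`leftEnd_superadd`). It holds because each new gap is no longer than any older one. For a solution
of total `α + m` it forces the Cantor values to add up to at least `m + 1`, which is the inequality
required (`HasCantorShape.one_le_sum`).

For the facet property, let `π'` be valid and tight wherever `ψ_i` is. The symmetry `ψ_i(x) + ψ_i(α
- x) = 1` and all additivity relations of `ψ_i` pass to `π'`, hence the difference `D` is bounded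
and inherits these additivities. Bounded additive functions on an interval are linear, so `D`
vanishes on `[-(1-α), 0]` and has some slope `d` on `[0, l]`. Translating by the `a_k`, `D` has
slope `d` on every interval of increase and slope `0` on every gap. Periodicity then gives `d = 0`
(`HasCantorShape.eq_zero_of_additive`). -/

/-- The length of the intervals of positive slope of `ψ_i`. -/
noncomputable def pieceLength (α : ℝ) (ε : ℕ → ℝ) : ℕ → ℝ
  | 0 => α
  | i + 1 => (pieceLength α ε i - ε (i + 1)) / 2

/-- The left endpoint of the `k`-th interval of positive slope of the periodic extension
of `ψ_i`. -/
noncomputable def leftEnd (α : ℝ) (ε : ℕ → ℝ) : ℕ → ℕ → ℝ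
  | 0, k => k
  | i + 1, k => leftEnd α ε i (k / 2) +
      ((k % 2 : ℕ) : ℝ) * (pieceLength α ε (i + 1) + ε (i + 1))

/-- The assumptions on `α` and `ε`, with summability replaced by what it implies for the
intervals of positive slope. -/
structure IsAdmissible (α : ℝ) (ε : ℕ → ℝ) : Prop where
  pos : 0 < α
  lt_one : α < 1
  eps_pos : ∀ i, 0 < ε (i + 1)
  eps_le : ∀ i, ε (i + 1) ≤ 1 - α
  eps_anti : ∀ i, ε (i + 2) ≤ ε (i + 1)
  length_pos : ∀ i, 0 < pieceLength α ε i

/-- The value at `x` of `ψ_i` is `cantorForm α y x` when the `i`-th Cantor function equals `y`. -/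
noncomputable def cantorForm (α y x : ℝ) : ℝ := (y - x) / (1 - α)

/-- `g` agrees on `[0,1]` with the piecewise linear function `ψ_i`, in explicit form. -/
structure HasCantorShape (α : ℝ) (ε : ℕ → ℝ) (i : ℕ) (g : ℝ → ℝ) : Prop where
  inc : ∀ k < 2 ^ i, ∀ x, leftEnd α ε i k ≤ x → x ≤ leftEnd α ε i k + pieceLength α ε i →
    g x = cantorForm α ((k + (x - leftEnd α ε i k) / pieceLength α ε i) / 2 ^ i) x
  dec : ∀ k < 2 ^ i, ∀ x, leftEnd α ε i k + pieceLength α ε i ≤ x → x ≤ leftEnd α ε i (k + 1) →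
    g x = cantorForm α ((k + 1) / 2 ^ i) x

/-! ### Arithmetic of the interval endpoints: gaps, symmetry, superadditivity. -/

section Endpoints

variable {α : ℝ} {ε : ℕ → ℝ}

lemma two_pow_mul_pieceLength (i : ℕ) :
    (2 : ℝ) ^ i * pieceLength α ε i = α - ∑ j ∈ Finset.range i, (2 : ℝ) ^ j * ε (j + 1) := by
  induction i with
  | zero => simp [pieceLength]
  | succ i ih =>
    rw [Finset.sum_range_succ, ← sub_sub, ← ih, pieceLength]
    ring

lemma pieceLength_eq (i : ℕ) :
    pieceLength α ε i = 2 * pieceLength α ε (i + 1) + ε (i + 1) := by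
  rw [pieceLength]; ring

lemma leftEnd_even (i m : ℕ) : leftEnd α ε (i + 1) (2 * m) = leftEnd α ε i m := by
  simp [leftEnd]

lemma leftEnd_odd (i m : ℕ) : leftEnd α ε (i + 1) (2 * m + 1) =
    leftEnd α ε i m + (pieceLength α ε (i + 1) + ε (i + 1)) := by
  have h1 : (2 * m + 1) / 2 = m := by omega
  have h2 : (2 * m + 1) % 2 = 1 := by omega
  rw [leftEnd, h1, h2]; simp

lemma leftEnd_zero (i : ℕ) : leftEnd α ε i 0 = 0 := by
  induction i with
  | zero => simp [leftEnd]
  | succ i ih => simpa [ih] using leftEnd_even (α := α) (ε := ε) i 0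

lemma leftEnd_two_pow_mul (i n : ℕ) : leftEnd α ε i (2 ^ i * n) = n := by
  induction i with
  | zero => simp [leftEnd]
  | succ i ih => rw [pow_succ', mul_assoc, leftEnd_even, ih]

lemma leftEnd_two_pow (i : ℕ) : leftEnd α ε i (2 ^ i) = 1 := by
  simpa using leftEnd_two_pow_mul (α := α) (ε := ε) i 1

/-- The reflection `x ↦ α - x` reverses the order of the intervals in `[0, α]`; this is the source
of the symmetry of `ψ_i`. -/
lemma leftEnd_symm (i : ℕ) : ∀ j k : ℕ, j + k + 1 = 2 ^ i →
    leftEnd α ε i j + leftEnd α ε i k + pieceLength α ε i = α := by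
  induction i with
  | zero =>
    intro j k h
    obtain ⟨rfl, rfl⟩ : j = 0 ∧ k = 0 := by constructor <;> simp at h <;> omega
    simp [leftEnd, pieceLength]
  | succ i ih =>
    intro j k h
    rw [pow_succ'] at h
    have hl := pieceLength_eq (α := α) (ε := ε) i
    rcases Nat.even_or_odd' j with ⟨m, rfl | rfl⟩ <;> rcases Nat.even_or_odd' k with ⟨n, rfl | rfl⟩
    · omega
    · rw [leftEnd_even, leftEnd_odd]
      linarith [ih m n (by omega)]
    · rw [leftEnd_even, leftEnd_odd]
      linarith [ih m n (by omega)]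
    · omega

/-- The right endpoint of the last interval of positive slope in `[n,n+1]`. -/
lemma leftEnd_add_length_last (i n k : ℕ) (h : k + 1 = 2 ^ i * (n + 1)) :
    leftEnd α ε i k + pieceLength α ε i = α + n := by
  induction i generalizing k with
  | zero =>
    obtain rfl : k = n := by simp at h; omega
    simp [leftEnd, pieceLength, add_comm]
  | succ i ih =>
    rw [pow_succ', mul_assoc] at h
    obtain ⟨m, rfl⟩ : ∃ m, k = 2 * m + 1 := ⟨2 ^ i * (n + 1) - 1, by omega⟩
    rw [leftEnd_odd]
    linarith [ih m (by omega), pieceLength_eq (α := α) (ε := ε) i]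

variable (H : IsAdmissible α ε)
include H

/-- The gaps at level `i` are the outer ones, of length `1 - α`, and those cut out earlier; none is
shorter than the gap about to be cut, since `ε` is nonincreasing. -/
lemma leftEnd_succ_ge (i k : ℕ) :
    leftEnd α ε i k + pieceLength α ε i + ε (i + 1) ≤ leftEnd α ε i (k + 1) := by
  induction i generalizing k with
  | zero =>
    simp only [leftEnd, pieceLength, Nat.cast_add, Nat.cast_one]
    linarith [H.eps_le 0]
  | succ i ih =>
    have hl := pieceLength_eq (α := α) (ε := ε) i
    have he := H.eps_anti i
    rcases Nat.even_or_odd' k with ⟨m, rfl | rfl⟩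
    · rw [leftEnd_even, leftEnd_odd]
      linarith
    · rw [leftEnd_odd, show 2 * m + 1 + 1 = 2 * (m + 1) by ring, leftEnd_even]
      linarith [ih m]

/-- Keeps every gap within the range `[-(1-α), 0]` of translations on which `ψ_i` is linear. -/
lemma leftEnd_succ_le (i k : ℕ) :
    leftEnd α ε i (k + 1) ≤ leftEnd α ε i k + pieceLength α ε i + (1 - α) := by
  induction i generalizing k with
  | zero =>
    simp only [leftEnd, pieceLength, Nat.cast_add, Nat.cast_one]
    linarith
  | succ i ih =>
    have hl := pieceLength_eq (α := α) (ε := ε) i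
    have he := H.eps_le i
    rcases Nat.even_or_odd' k with ⟨m, rfl | rfl⟩
    · rw [leftEnd_even, leftEnd_odd]
      linarith
    · rw [leftEnd_odd, show 2 * m + 1 + 1 = 2 * (m + 1) by ring, leftEnd_even]
      linarith [ih m]

lemma leftEnd_superadd (i j k : ℕ) :
    leftEnd α ε i j + leftEnd α ε i k ≤ leftEnd α ε i (j + k) := by
  induction i generalizing j k with
  | zero => simp [leftEnd]
  | succ i ih =>
    rcases Nat.even_or_odd' j with ⟨m, rfl | rfl⟩ <;> rcases Nat.even_or_odd' k with ⟨n, rfl | rfl⟩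
    · rw [← mul_add, leftEnd_even, leftEnd_even, leftEnd_even]
      exact ih m n
    · rw [show 2 * m + (2 * n + 1) = 2 * (m + n) + 1 by ring, leftEnd_even, leftEnd_odd, leftEnd_odd]
      linarith [ih m n]
    · rw [show 2 * m + 1 + 2 * n = 2 * (m + n) + 1 by ring, leftEnd_even, leftEnd_odd, leftEnd_odd]
      linarith [ih m n]
    -- The only case with a carry: the two odd offsets add up to `2 * (l' + ε) = l + ε`, with `l'`
    -- the new length, and the interval and gap following `a_{m+n}` have room for that.
    · rw [show 2 * m + 1 + (2 * n + 1) = 2 * (m + n + 1) by ring, leftEnd_even, leftEnd_odd,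
        leftEnd_odd]
      linarith [ih m n, leftEnd_succ_ge H i (m + n), pieceLength_eq (α := α) (ε := ε) i]

lemma nsmul_leftEnd_le (i n k : ℕ) : (n : ℝ) * leftEnd α ε i k ≤ leftEnd α ε i (n * k) := by
  induction n with
  | zero => simp [leftEnd_zero]
  | succ n ih =>
    rw [Nat.succ_mul]
    push_cast
    linarith [leftEnd_superadd H i (n * k) k]

/-- Superadditivity applied to `2 ^ i` copies of `k`, where the endpoint is the integer `k`. -/
lemma leftEnd_le (i k : ℕ) : 2 ^ i * leftEnd α ε i k ≤ k := by
  have := nsmul_leftEnd_le H i (2 ^ i) k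
  rw [leftEnd_two_pow_mul] at this
  exact_mod_cast this

lemma leftEnd_add_mul_le (i k m : ℕ) :
    leftEnd α ε i k + m * pieceLength α ε i ≤ leftEnd α ε i (k + m) := by
  induction m with
  | zero => simp
  | succ m ih =>
    push_cast
    rw [← add_assoc k]
    linarith [leftEnd_succ_ge H i (k + m), H.eps_pos i]

lemma leftEnd_add_length_le {i j k : ℕ} (h : j < k) :
    leftEnd α ε i j + pieceLength α ε i + ε (i + 1) ≤ leftEnd α ε i k := by
  obtain ⟨m, rfl⟩ := Nat.exists_eq_add_of_lt h
  rw [show j + m + 1 = (j + 1) + m by ring]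
  have h1 := leftEnd_add_mul_le H i (j + 1) m
  have h2 : 0 ≤ m * pieceLength α ε i := mul_nonneg (Nat.cast_nonneg m) (H.length_pos i).le
  linarith [leftEnd_succ_ge H i j]

lemma leftEnd_nonneg (i k : ℕ) : 0 ≤ leftEnd α ε i k := by
  have h := leftEnd_add_mul_le H i 0 k
  have h2 : 0 ≤ k * pieceLength α ε i := mul_nonneg (Nat.cast_nonneg k) (H.length_pos i).le
  rw [leftEnd_zero, zero_add] at h
  simpa using h2.trans (by simpa using h)

lemma leftEnd_add_length_le_alpha {i k : ℕ} (hk : k < 2 ^ i) :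
    leftEnd α ε i k + pieceLength α ε i ≤ α := by
  linarith [leftEnd_symm (α := α) (ε := ε) i k (2 ^ i - 1 - k) (by omega),
    leftEnd_nonneg H i (2 ^ i - 1 - k)]

omit H in
lemma exists_leftEnd_mem (i : ℕ) {x : ℝ} (hx : 0 ≤ x) (n : ℕ) (hn : 0 < n)
    (hxn : x ≤ leftEnd α ε i n) :
    ∃ k < n, leftEnd α ε i k ≤ x ∧ x ≤ leftEnd α ε i (k + 1) := by
  induction n with
  | zero => omega
  | succ n ih =>
    rcases le_total (leftEnd α ε i n) x with h | h
    · exact ⟨n, by omega, h, hxn⟩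
    · rcases Nat.eq_zero_or_pos n with rfl | hn
      · exact ⟨0, by omega, by rwa [leftEnd_zero], hxn⟩
      · obtain ⟨k, hk, h'⟩ := ih hn h
        exact ⟨k, by omega, h'⟩

omit H in
lemma exists_leftEnd_mem_unit (i : ℕ) {x : ℝ} (hx : 0 ≤ x) (hx1 : x ≤ 1) :
    ∃ k < 2 ^ i, leftEnd α ε i k ≤ x ∧ x ≤ leftEnd α ε i (k + 1) :=
  exists_leftEnd_mem i hx (2 ^ i) (by positivity) (by rwa [leftEnd_two_pow])

end Endpoints

/-! ### The recursive construction yields the explicit Cantor form. -/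

section Shape

variable {α : ℝ} {ε : ℕ → ℝ} {i : ℕ} {g : ℝ → ℝ}

lemma hasConstPosSlope_lt {g : ℝ → ℝ} {a b x y : ℝ} (h : HasConstPosSlope g a b)
    (hx : a ≤ x) (hxy : x < y) (hy : y ≤ b) : g x < g y := by
  obtain ⟨-, m, hm, hg⟩ := h
  rw [hg x ⟨hx, by linarith⟩, hg y ⟨by linarith, hy⟩]
  nlinarith

lemma HasCantorShape.hasConstPosSlope (H : IsAdmissible α ε) (S : HasCantorShape α ε i g) {k : ℕ}
    (hk : k < 2 ^ i) :
    HasConstPosSlope g (leftEnd α ε i k) (leftEnd α ε i k + pieceLength α ε i) := by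
  have hl := H.length_pos i
  have h1 : 0 < 1 - α := by linarith [H.lt_one]
  have h2 : 2 ^ i * pieceLength α ε i < 1 := by
    have := leftEnd_add_mul_le H i 0 (2 ^ i)
    have h3 := leftEnd_add_length_last (α := α) (ε := ε) i 0 (2 ^ i - 1)
      (by have := Nat.one_le_two_pow (n := i); omega)
    have h4 := leftEnd_add_mul_le H i 0 (2 ^ i - 1)
    rw [Nat.cast_sub Nat.one_le_two_pow, leftEnd_zero, zero_add, zero_add] at h4
    push_cast at h3 h4
    linarith [H.lt_one]
  -- The Cantor part has slope `1 / (2 ^ i * l)`, which exceeds the slope `1` of the subtracted `x`.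
  refine ⟨by linarith, (1 / (2 ^ i * pieceLength α ε i) - 1) / (1 - α), ?_, ?_⟩
  · apply div_pos _ h1
    rw [sub_pos, lt_div_iff₀ (by positivity)]
    linarith
  · rintro x ⟨hx, hx'⟩
    rw [S.inc k hk x hx hx', S.inc k hk _ le_rfl (by linarith), cantorForm, cantorForm]
    field_simp
    ring

/-- An interval of positive slope cannot overlap a gap in more than a point, because `g` strictly
decreases there. -/
lemma HasCantorShape.gap_disjoint (H : IsAdmissible α ε) (S : HasCantorShape α ε i g) {k : ℕ}
    (hk : k < 2 ^ i) {a b : ℝ} (h : HasConstPosSlope g a b) (ha : a < leftEnd α ε i (k + 1)) :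
    b ≤ leftEnd α ε i k + pieceLength α ε i := by
  by_contra! hb
  have hab := h.1
  set u := max a (leftEnd α ε i k + pieceLength α ε i) with hu
  set v := min b (leftEnd α ε i (k + 1)) with hv
  have huv : u < v := by
    have := leftEnd_succ_ge H i k
    have := H.eps_pos i
    rw [hu, hv, max_lt_iff, lt_min_iff, lt_min_iff]
    refine ⟨⟨hab, ha⟩, hb, by linarith⟩
  have h1 := hasConstPosSlope_lt h (le_max_left _ _) huv (min_le_left _ _)
  have h2 : leftEnd α ε i k + pieceLength α ε i ≤ u := le_max_right _ _
  have h3 : v ≤ leftEnd α ε i (k + 1) := min_le_right _ _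
  rw [S.dec k hk u h2 (by linarith), S.dec k hk v (by linarith) h3, cantorForm, cantorForm,
    div_lt_div_iff_of_pos_right (by linarith [H.lt_one])] at h1
  linarith

lemma HasCantorShape.exists_of_constPosSlope (H : IsAdmissible α ε) (S : HasCantorShape α ε i g)
    {a b : ℝ} (ha : 0 ≤ a) (hb : b ≤ α) (h : HasConstPosSlope g a b) :
    ∃ k < 2 ^ i, leftEnd α ε i k ≤ a ∧ b ≤ leftEnd α ε i k + pieceLength α ε i := by
  have hab := h.1
  obtain ⟨k, hk, h1, h2⟩ := exists_leftEnd_mem_unit (α := α) (ε := ε) i ha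
    (by linarith [H.lt_one])
  rcases h2.lt_or_eq with h2 | h2
  · exact ⟨k, hk, h1, S.gap_disjoint H hk h h2⟩
  -- Here `a` is the right end of a gap, so it belongs to the next interval, which exists because `a
  -- < 1`.
  · have hk1 : k + 1 < 2 ^ i := by
      refine lt_of_le_of_ne hk fun h3 => ?_
      rw [h3, leftEnd_two_pow] at h2
      linarith [H.lt_one]
    refine ⟨k + 1, hk1, h2.ge, S.gap_disjoint H hk1 h ?_⟩
    linarith [leftEnd_succ_ge H i (k + 1), H.length_pos i, H.eps_pos i]

lemma HasCantorShape.isMaxPosSlope (H : IsAdmissible α ε) (S : HasCantorShape α ε i g) {k : ℕ}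
    (hk : k < 2 ^ i) :
    IsMaxPosSlope α g (leftEnd α ε i k) (leftEnd α ε i k + pieceLength α ε i) := by
  refine ⟨leftEnd_nonneg H i k, leftEnd_add_length_le_alpha H hk, S.hasConstPosSlope H hk, ?_⟩
  intro a' b' ha hb h h1 h2
  obtain ⟨m, hm, h3, h4⟩ := S.exists_of_constPosSlope H ha hb h
  have hl := H.length_pos i
  have he := H.eps_pos i
  rcases lt_trichotomy k m with hkm | rfl | hkm
  · linarith [leftEnd_add_length_le H (i := i) hkm]
  · constructor <;> linarith
  · linarith [leftEnd_add_length_le H (i := i) hkm]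

lemma HasCantorShape.exists_of_isMaxPosSlope (H : IsAdmissible α ε) (S : HasCantorShape α ε i g)
    {a b : ℝ} (h : IsMaxPosSlope α g a b) :
    ∃ k < 2 ^ i, a = leftEnd α ε i k ∧ b = leftEnd α ε i k + pieceLength α ε i := by
  obtain ⟨ha, hb, hs, hmax⟩ := h
  obtain ⟨k, hk, h1, h2⟩ := S.exists_of_constPosSlope H ha hb hs
  obtain ⟨h3, h4⟩ := hmax _ _ (leftEnd_nonneg H i k) (leftEnd_add_length_le_alpha H hk)
    (S.hasConstPosSlope H hk) h1 h2
  exact ⟨k, hk, h3.symm, h4.symm⟩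

lemma HasCantorShape.refineStep_of_mem (H : IsAdmissible α ε) (S : HasCantorShape α ε i g) (e : ℝ)
    {k : ℕ} (hk : k < 2 ^ i) {x : ℝ} (hx : leftEnd α ε i k ≤ x)
    (hx' : x ≤ leftEnd α ε i k + pieceLength α ε i) :
    refineStep α e g x = threeSegments α e g (leftEnd α ε i k)
      (leftEnd α ε i k + pieceLength α ε i) x := by
  have h : ∃ p : ℝ × ℝ, IsMaxPosSlope α g p.1 p.2 ∧ x ∈ Set.Icc p.1 p.2 :=
    ⟨(_, _), S.isMaxPosSlope H hk, hx, hx'⟩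
  rw [refineStep, dif_pos h]
  obtain ⟨h1, h2, h3⟩ := h.choose_spec
  obtain ⟨m, hm, h4, h5⟩ := S.exists_of_isMaxPosSlope H h1
  have he := H.eps_pos i
  rw [h4] at h2 ⊢
  rw [h5] at h3 ⊢
  rcases lt_trichotomy k m with hkm | rfl | hkm
  · linarith [leftEnd_add_length_le H (i := i) hkm]
  · rfl
  · linarith [leftEnd_add_length_le H (i := i) hkm]

lemma HasCantorShape.refineStep_of_gap (H : IsAdmissible α ε) (S : HasCantorShape α ε i g) (e : ℝ)
    {k : ℕ} {x : ℝ} (hx : leftEnd α ε i k + pieceLength α ε i < x)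
    (hx' : x < leftEnd α ε i (k + 1)) : refineStep α e g x = g x := by
  rw [refineStep, dif_neg]
  rintro ⟨⟨a, b⟩, h1, h2, h3⟩
  obtain ⟨m, hm, rfl, rfl⟩ := S.exists_of_isMaxPosSlope H h1
  have he := H.eps_pos i
  have hl := H.length_pos i
  dsimp only at h2 h3
  rcases Nat.lt_trichotomy m (k + 1) with hkm | rfl | hkm
  · rcases (Nat.lt_succ_iff.mp hkm).lt_or_eq with hkm | rfl
    · linarith [leftEnd_add_length_le H (i := i) hkm]
    · linarith
  · linarith
  · linarith [leftEnd_add_length_le H (i := i) hkm]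

lemma refineStep_one (hα : α < 1) (e : ℝ) (g : ℝ → ℝ) :
    refineStep α e g 1 = g 1 := by
  rw [refineStep, dif_neg]
  rintro ⟨⟨a, b⟩, h1, h2, h3⟩
  dsimp only at h3
  linarith [h1.2.1]

/-! ### Cantor values along the three segments over an interval of length `2 * l + e`. -/

section ThreeSegments

variable {e l a t d : ℝ} (hα : α < 1) (he : 0 < e) (hl : 0 < l)
  (h0 : g a = cantorForm α t a)
  (h1 : g ((a + (a + (2 * l + e))) / 2) = cantorForm α (t + d) ((a + (a + (2 * l + e))) / 2))
  (h2 : g (a + (2 * l + e)) = cantorForm α (t + 2 * d) (a + (2 * l + e)))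

include hα hl h0 h1 in
lemma threeSegments_left {x : ℝ} (hx : x ≤ a + l) :
    threeSegments α e g a (a + (2 * l + e)) x = cantorForm α (t + d * ((x - a) / l)) x := by
  have hα' : 1 - α ≠ 0 := by linarith
  rw [threeSegments, if_pos (by linarith), segmentThrough, h0, h1]
  have h3 : (a + (a + (2 * l + e)) - e) / 2 - a = l := by ring
  rw [h3]
  simp only [cantorForm]
  field_simp
  ring

-- The middle segment drops by `e / (1 - α)` over a length `e`, which is exactly the slope of
-- `cantorForm` at a fixed Cantor value.
include hα he hl h0 h1 in
lemma threeSegments_middle {x : ℝ} (hx : a + l ≤ x) (hx' : x ≤ a + l + e) :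
    threeSegments α e g a (a + (2 * l + e)) x = cantorForm α (t + d) x := by
  have hα' : 1 - α ≠ 0 := by linarith
  rcases hx.lt_or_eq with hx | rfl
  · rw [threeSegments, if_neg (by linarith), if_pos (by linarith), segmentThrough, h1]
    have h3 : (a + (a + (2 * l + e)) + e) / 2 - (a + (a + (2 * l + e)) - e) / 2 = e := by ring
    rw [h3]
    simp only [cantorForm]
    field_simp
    ring
  · rw [threeSegments_left hα hl h0 h1 le_rfl, add_sub_cancel_left, div_self hl.ne', mul_one]

include hα he hl h0 h1 h2 in
lemma threeSegments_right {x : ℝ} (hx : a + l + e ≤ x) :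
    threeSegments α e g a (a + (2 * l + e)) x =
      cantorForm α (t + d + d * ((x - (a + (l + e))) / l)) x := by
  have hα' : 1 - α ≠ 0 := by linarith
  rcases hx.lt_or_eq with hx | rfl
  · rw [threeSegments, if_neg (by linarith), if_neg (by linarith), segmentThrough, h1, h2]
    have h3 : a + (2 * l + e) - (a + (a + (2 * l + e)) + e) / 2 = l := by ring
    rw [h3]
    simp only [cantorForm]
    field_simp
    ring
  · rw [threeSegments_middle hα he hl h0 h1 (by linarith) le_rfl]
    congr 1
    ring

end ThreeSegments

lemma HasCantorShape.refineStep_value (H : IsAdmissible α ε) (S : HasCantorShape α ε i g)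
    {k : ℕ} (hk : k < 2 ^ i) (x : ℝ) :
    (leftEnd α ε i k ≤ x → x ≤ leftEnd α ε i k + pieceLength α ε (i + 1) →
      refineStep α (ε (i + 1)) g x = cantorForm α
        (k / 2 ^ i + 1 / 2 ^ (i + 1) * ((x - leftEnd α ε i k) / pieceLength α ε (i + 1))) x) ∧
    (leftEnd α ε i k + pieceLength α ε (i + 1) ≤ x →
      x ≤ leftEnd α ε i k + pieceLength α ε (i + 1) + ε (i + 1) →
      refineStep α (ε (i + 1)) g x = cantorForm α (k / 2 ^ i + 1 / 2 ^ (i + 1)) x) ∧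
    (leftEnd α ε i k + pieceLength α ε (i + 1) + ε (i + 1) ≤ x →
      x ≤ leftEnd α ε i k + pieceLength α ε i →
      refineStep α (ε (i + 1)) g x = cantorForm α (k / 2 ^ i + 1 / 2 ^ (i + 1) +
        1 / 2 ^ (i + 1) * ((x - (leftEnd α ε i k + (pieceLength α ε (i + 1) + ε (i + 1)))) /
          pieceLength α ε (i + 1))) x) := by
  have he := H.eps_pos i
  have hl := H.length_pos (i + 1)
  have hα := H.lt_one
  have hL := pieceLength_eq (α := α) (ε := ε) i
  have key : ∀ y, leftEnd α ε i k ≤ y → y ≤ leftEnd α ε i k + pieceLength α ε i →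
      g y = cantorForm α ((k + (y - leftEnd α ε i k) / pieceLength α ε i) / 2 ^ i) y :=
    S.inc k hk
  have step := fun h h' => S.refineStep_of_mem H (ε (i + 1)) hk (x := x) h h'
  rw [hL] at key step ⊢
  have h0 : g (leftEnd α ε i k) = cantorForm α (k / 2 ^ i) (leftEnd α ε i k) := by
    rw [key _ le_rfl (by linarith)]; simp
  have h1 := key ((leftEnd α ε i k + (leftEnd α ε i k + (2 * pieceLength α ε (i + 1) +
    ε (i + 1)))) / 2) (by linarith) (by linarith)
  have h2 := key (leftEnd α ε i k + (2 * pieceLength α ε (i + 1) + ε (i + 1)))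
    (by linarith) le_rfl
  have hne : 2 * pieceLength α ε (i + 1) + ε (i + 1) ≠ 0 := by linarith
  rw [show ((k : ℝ) + ((leftEnd α ε i k + (leftEnd α ε i k + (2 * pieceLength α ε (i + 1) +
    ε (i + 1)))) / 2 - leftEnd α ε i k) / (2 * pieceLength α ε (i + 1) + ε (i + 1))) / 2 ^ i =
    k / 2 ^ i + 1 / 2 ^ (i + 1) by field_simp; ring] at h1
  rw [show ((k : ℝ) + (leftEnd α ε i k + (2 * pieceLength α ε (i + 1) +
    ε (i + 1)) - leftEnd α ε i k) / (2 * pieceLength α ε (i + 1) + ε (i + 1))) / 2 ^ i =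
    k / 2 ^ i + 2 * (1 / 2 ^ (i + 1)) by field_simp; ring] at h2
  refine ⟨fun h h' => ?_, fun h h' => ?_, fun h h' => ?_⟩
  · rw [step h (by linarith), threeSegments_left hα hl h0 h1 h']
  · rw [step (by linarith) (by linarith), threeSegments_middle hα he hl h0 h1 h h']
  · rw [step (by linarith) h', threeSegments_right hα he hl h0 h1 h2 h]

lemma HasCantorShape.refineStep (H : IsAdmissible α ε) (S : HasCantorShape α ε i g) :
    HasCantorShape α ε (i + 1) (refineStep α (ε (i + 1)) g) := by
  have he := H.eps_pos i
  have hl := H.length_pos (i + 1)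
  have hL := pieceLength_eq (α := α) (ε := ε) i
  constructor
  · intro k hk x
    rw [pow_succ'] at hk
    rcases Nat.even_or_odd' k with ⟨m, rfl | rfl⟩
    · rw [leftEnd_even]
      intro hx hx'
      rw [(S.refineStep_value H (k := m) (by omega) x).1 hx hx']
      congr 1
      push_cast
      field_simp
      ring
    · rw [leftEnd_odd]
      intro hx hx'
      rw [(S.refineStep_value H (k := m) (by omega) x).2.2 (by linarith) (by linarith)]
      congr 1
      push_cast
      field_simp
      ring
  · intro k hk x
    rw [pow_succ'] at hk
    rcases Nat.even_or_odd' k with ⟨m, rfl | rfl⟩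
    · rw [leftEnd_even, leftEnd_odd]
      intro hx hx'
      rw [(S.refineStep_value H (k := m) (by omega) x).2.1 hx (by linarith)]
      congr 1
      push_cast
      field_simp
      ring
    · rw [leftEnd_odd, show 2 * m + 1 + 1 = 2 * (m + 1) by ring, leftEnd_even]
      intro hx hx'
      have hm : m < 2 ^ i := by omega
      have hg := S.dec m hm x (by linarith) hx'
      have target : ((((2 * m + 1 : ℕ) : ℝ) + 1) / 2 ^ (i + 1)) = ((m : ℝ) + 1) / 2 ^ i := by
        push_cast
        field_simp
        ring
      rw [target]
      -- An old gap is untouched in its interior, but its endpoints lie on refined intervals, except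
      -- for the right endpoint `1` of the last gap.
      rcases hx.lt_or_eq with hx | rfl
      · rcases hx'.lt_or_eq with hx' | rfl
        · rw [S.refineStep_of_gap H _ (k := m) (by linarith) hx', hg]
        · rcases Nat.lt_or_eq_of_le (Nat.succ_le_of_lt hm) with hm | hm
          · rw [(S.refineStep_value H (k := m + 1) hm _).1 le_rfl (by linarith)]
            simp
          · rw [Nat.succ_eq_add_one] at hm
            rw [hm, leftEnd_two_pow] at hg ⊢
            rw [refineStep_one H.lt_one, hg]
      · rw [(S.refineStep_value H (k := m) hm _).2.2 (by linarith) (by linarith)]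
        congr 1
        field_simp
        ring

lemma psiReal_hasCantorShape (H : IsAdmissible α ε) (i : ℕ) :
    HasCantorShape α ε i (psiReal α ε i) := by
  induction i with
  | succ i ih => exact ih.refineStep H
  | zero =>
    have h0 := H.pos
    have h1 : 1 - α ≠ 0 := by linarith [H.lt_one]
    constructor
    · intro k hk x hx hx'
      obtain rfl : k = 0 := by simpa using hk
      simp only [leftEnd, pieceLength, Nat.cast_zero, zero_add, pow_zero, psiReal, cantorForm]
        at hx hx' ⊢
      rw [if_pos hx']
      field_simp
      ring
    · intro k hk x hx hx'
      obtain rfl : k = 0 := by simpa using hk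
      simp only [leftEnd, pieceLength, Nat.cast_zero, zero_add, pow_zero, psiReal, cantorForm]
        at hx hx' ⊢
      rcases hx.lt_or_eq with hx | rfl
      · rw [if_neg (by linarith)]
        simp
      · rw [if_pos le_rfl]
        field_simp

end Shape

/-! ### Nonnegativity, symmetry and validity. -/

section Validity

variable {α : ℝ} {ε : ℕ → ℝ} {i : ℕ} {g : ℝ → ℝ}

/-- On `[0,1]` the function is one of the convex functions whose minimum is the subadditive
Cantor function. -/
lemma HasCantorShape.exists_eq_max (S : HasCantorShape α ε i g) {x : ℝ}
    (hx : 0 ≤ x) (hx1 : x ≤ 1) :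
    ∃ k : ℕ, g x =
      cantorForm α ((k + max 0 (x - leftEnd α ε i k) / pieceLength α ε i) / 2 ^ i) x := by
  obtain ⟨k, hk, h1, h2⟩ := exists_leftEnd_mem_unit (α := α) (ε := ε) i hx hx1
  rcases le_total x (leftEnd α ε i k + pieceLength α ε i) with h3 | h3
  · refine ⟨k, ?_⟩
    rw [max_eq_right (by linarith), S.inc k hk x h1 h3]
  · refine ⟨k + 1, ?_⟩
    rw [max_eq_left (by linarith), S.dec k hk x h3 h2]
    simp

lemma two_pow_mul_pieceLength_le_one (H : IsAdmissible α ε) (i : ℕ) :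
    2 ^ i * pieceLength α ε i ≤ 1 := by
  have := leftEnd_add_mul_le H i 0 (2 ^ i)
  rw [zero_add, leftEnd_two_pow, leftEnd_zero, zero_add] at this
  exact_mod_cast this

/-- The Cantor function lies above the diagonal: its breakpoints satisfy `a_k ≤ k / 2 ^ i`, and its
positive slope is at least `1`. -/
lemma HasCantorShape.nonneg (H : IsAdmissible α ε) (S : HasCantorShape α ε i g) {x : ℝ}
    (hx : 0 ≤ x) (hx1 : x ≤ 1) : 0 ≤ g x := by
  obtain ⟨k, hk⟩ := S.exists_eq_max hx hx1
  have hl := H.length_pos i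
  have h1 := two_pow_mul_pieceLength_le_one H i
  have h2 := leftEnd_le H i k
  have hα := H.lt_one
  have h3 : 2 ^ i * max 0 (x - leftEnd α ε i k) ≤
      max 0 (x - leftEnd α ε i k) / pieceLength α ε i := by
    rw [le_div_iff₀ hl]
    have := mul_le_mul_of_nonneg_right h1 (le_max_left 0 (x - leftEnd α ε i k))
    linarith
  have h4 : 2 ^ i * (x - leftEnd α ε i k) ≤ 2 ^ i * max 0 (x - leftEnd α ε i k) :=
    mul_le_mul_of_nonneg_left (le_max_right _ _) (by positivity)
  rw [hk, cantorForm]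
  refine div_nonneg ?_ (by linarith)
  rw [sub_nonneg, le_div_iff₀ (by positivity)]
  linarith

lemma HasCantorShape.map_zero (H : IsAdmissible α ε) (S : HasCantorShape α ε i g) : g 0 = 0 := by
  have := S.inc 0 (by positivity) 0 (by rw [leftEnd_zero])
    (by rw [leftEnd_zero]; linarith [H.length_pos i])
  rw [this, leftEnd_zero]
  simp [cantorForm]

lemma HasCantorShape.map_of_alpha_le (S : HasCantorShape α ε i g) {x : ℝ}
    (hx : α ≤ x) (hx1 : x ≤ 1) : g x = (1 - x) / (1 - α) := by
  have h1 : 2 ^ i - 1 + 1 = 2 ^ i := Nat.sub_add_cancel Nat.one_le_two_pow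
  have h2 := leftEnd_add_length_last (α := α) (ε := ε) i 0 (2 ^ i - 1) (by simpa using h1)
  rw [S.dec (2 ^ i - 1) (by omega) x (by simpa [h2] using hx) (by simpa [h1, leftEnd_two_pow]),
    cantorForm]
  have h3 : (((2 ^ i - 1 : ℕ) : ℝ) + 1) = 2 ^ i := by exact_mod_cast h1
  rw [h3, div_self (by positivity)]

lemma HasCantorShape.add_symm (H : IsAdmissible α ε) (S : HasCantorShape α ε i g) {x : ℝ}
    (hx : 0 ≤ x) (hxα : x ≤ α) : g x + g (α - x) = 1 := by
  have hl := H.length_pos i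
  have hα := H.lt_one
  have hα' : 1 - α ≠ 0 := by linarith
  obtain ⟨k, hk, h1, h2⟩ := exists_leftEnd_mem_unit (α := α) (ε := ε) i hx (by linarith)
  have hs := leftEnd_symm (α := α) (ε := ε) i
  rcases le_total x (leftEnd α ε i k + pieceLength α ε i) with h3 | h3
  · obtain ⟨j, hj⟩ : ∃ j, j + k + 1 = 2 ^ i := ⟨2 ^ i - 1 - k, by omega⟩
    have h4 := hs j k hj
    have h5 : leftEnd α ε i j = α - leftEnd α ε i k - pieceLength α ε i := by linarith
    have h6 : (2 : ℝ) ^ i = j + k + 1 := by exact_mod_cast hj.symm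
    have h7 : (j : ℝ) + k + 1 ≠ 0 := by positivity
    rw [S.inc k hk x h1 h3, S.inc j (by omega) (α - x) (by linarith) (by linarith), h5, h6]
    simp only [cantorForm]
    field_simp
    ring
  · rcases Nat.lt_or_eq_of_le (Nat.succ_le_of_lt hk) with hk1 | hk1
    · obtain ⟨j, hj⟩ : ∃ j, j + (k + 1) + 1 = 2 ^ i := ⟨2 ^ i - 1 - (k + 1), by omega⟩
      have h4 := hs j (k + 1) hj
      have h5 := hs (j + 1) k (by omega)
      have h6 : (2 : ℝ) ^ i = j + (k + 1) + 1 := by exact_mod_cast hj.symm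
      have h7 : (j : ℝ) + (k + 1) + 1 ≠ 0 := by positivity
      rw [S.dec k hk x h3 h2, S.dec j (by omega) (α - x) (by linarith) (by linarith), h6]
      simp only [cantorForm]
      field_simp
      ring
    -- The last gap meets `[0, α]` only at `α`.
    · have h4 := leftEnd_add_length_last (α := α) (ε := ε) i 0 k (by simpa using hk1)
      obtain rfl : x = α := by simp at h4; linarith
      rw [sub_self, S.map_zero H, S.map_of_alpha_le le_rfl hα.le, div_self hα', add_zero]

/-- The combinatorial core of validity: multiplicities `n` of points `x` of total `α` modulo 1. -/
lemma HasCantorShape.one_le_sum {ι : Type*} (H : IsAdmissible α ε) (S : HasCantorShape α ε i g)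
    (s : Finset ι) (x : ι → ℝ) (n : ι → ℕ) (hx : ∀ r ∈ s, 0 ≤ x r) (hx1 : ∀ r ∈ s, x r ≤ 1)
    (m : ℕ) (hsum : ∑ r ∈ s, (n r : ℝ) * x r = α + m) :
    1 ≤ ∑ r ∈ s, g (x r) * n r := by
  have hl := H.length_pos i
  have hα : 0 < 1 - α := by linarith [H.lt_one]
  choose! k hk using fun r (hr : r ∈ s) => S.exists_eq_max (hx r hr) (hx1 r hr)
  set l := pieceLength α ε i
  have hsup : ∑ r ∈ s, (n r : ℝ) * leftEnd α ε i (k r) ≤ leftEnd α ε i (∑ r ∈ s, n r * k r) := by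
    classical
    clear hsum hx hx1 hk
    induction s using Finset.induction_on with
    | empty => simp [leftEnd_zero]
    | insert a s ha ih =>
      rw [Finset.sum_insert ha, Finset.sum_insert ha]
      linarith [leftEnd_superadd H i (n a * k a) (∑ r ∈ s, n r * k r), nsmul_leftEnd_le H i (n a) (k a)]
  set K := ∑ r ∈ s, n r * k r with hK
  set M := ∑ r ∈ s, (n r : ℝ) * max 0 (x r - leftEnd α ε i (k r)) with hM
  have hM0 : 0 ≤ M := Finset.sum_nonneg fun r _ => by positivity
  have hM1 : α + m - leftEnd α ε i K ≤ M := by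
    calc α + m - leftEnd α ε i K ≤ ∑ r ∈ s, (n r : ℝ) * (x r - leftEnd α ε i (k r)) := by
          simp only [mul_sub, Finset.sum_sub_distrib]
          linarith
      _ ≤ M := Finset.sum_le_sum fun r _ =>
          mul_le_mul_of_nonneg_left (le_max_right _ _) (Nat.cast_nonneg _)
  -- `cantorForm` is jointly linear in the Cantor value and the point, so the sum is again of this
  -- form.
  have htot : ∑ r ∈ s, g (x r) * n r = cantorForm α ((K + M / l) / 2 ^ i) (α + m) := by
    rw [cantorForm, ← hsum, hK, hM]
    push_cast
    rw [Finset.sum_div, ← Finset.sum_add_distrib, Finset.sum_div, ← Finset.sum_sub_distrib,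
      Finset.sum_div]
    refine Finset.sum_congr rfl fun r hr => ?_
    rw [hk r hr, cantorForm]
    ring
  have hmain : 2 ^ i * ((m : ℝ) + 1) ≤ K + M / l := by
    rcases le_or_gt (2 ^ i * (m + 1)) K with h | h
    · have h' : (2 : ℝ) ^ i * (m + 1) ≤ K := by exact_mod_cast h
      have : 0 ≤ M / l := by positivity
      linarith
    -- The interval of index `K + j` is the last one before `α + m`. The `j + 1` intervals from
    -- index `K` on all fit between `a_K` and `α + m`, so the excess `M` is at least `(j + 1) * l`.
    · obtain ⟨j, hj⟩ := Nat.exists_eq_add_of_lt h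
      have h1 := leftEnd_add_length_last (α := α) (ε := ε) i m (K + j) hj.symm
      have h2 := leftEnd_add_mul_le H i K j
      have h3 : (2 : ℝ) ^ i * (m + 1) = K + j + 1 := by exact_mod_cast hj
      have h4 : (j : ℝ) + 1 ≤ M / l := by
        rw [le_div_iff₀ hl]
        linarith
      linarith
  rw [htot, cantorForm, le_div_iff₀ hα]
  have : (m : ℝ) + 1 ≤ (K + M / l) / 2 ^ i := by
    rw [le_div_iff₀ (by positivity)]
    linarith
  linarith

lemma psi_isValid (H : IsAdmissible α ε) (i : ℕ) : IsValid α (psi α ε i) := by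
  have S := psiReal_hasCantorShape H i
  refine ⟨fun r => S.nonneg H r.2.1 r.2.2.le, S.map_zero H, ?_⟩
  rintro s ⟨k, hk⟩
  have h0 : 0 ≤ s.sum fun r n => (n : ℝ) * (r : ℝ) :=
    Finset.sum_nonneg fun r _ => mul_nonneg (Nat.cast_nonneg _) r.2.1
  -- The total `α + k` is nonnegative and `α < 1`.
  have hk0 : 0 ≤ k := by
    have : (-1 : ℝ) < k := by linarith [H.lt_one]
    have : -1 < k := by exact_mod_cast this
    omega
  lift k to ℕ using hk0
  exact S.one_le_sum H s.support (fun r => (r : ℝ)) s (fun r _ => r.2.1) (fun r _ => r.2.2.le) k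
    (by exact_mod_cast hk)

end Validity

/-! ### Transfer of tight relations and uniqueness. -/

section Facet

/-- The 1-periodic extension of a function on `[0,1[`. -/
noncomputable def periodicExt (π : UnitIco → ℝ) (x : ℝ) : ℝ :=
  π ⟨Int.fract x, Int.fract_nonneg x, Int.fract_lt_one x⟩

lemma periodicExt_of_mem (π : UnitIco → ℝ) (r : UnitIco) : periodicExt π r = π r := by
  rw [periodicExt]
  congr 1
  exact Subtype.ext (Int.fract_eq_self.2 r.2)

lemma periodicExt_add_one (π : UnitIco → ℝ) (x : ℝ) :
    periodicExt π (x + 1) = periodicExt π x := by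
  simp only [periodicExt, Int.fract_add_one]

/-- The finitely supported vector that counts the entries of a list of reals modulo 1. -/
noncomputable def countVector (L : List ℝ) : UnitIco →₀ ℕ :=
  (L.map fun x => Finsupp.single
    (⟨Int.fract x, Int.fract_nonneg x, Int.fract_lt_one x⟩ : UnitIco) 1).sum

lemma lhs_countVector (π : UnitIco → ℝ) (L : List ℝ) :
    lhs π (countVector L) = (L.map (periodicExt π)).sum := by
  induction L with
  | nil => simp [countVector, lhs]
  | cons x L ih =>
    simp only [lhs, countVector, List.map_cons, List.sum_cons] at ih ⊢
    rw [Finsupp.sum_add_index' (by simp) (by intros; push_cast; ring), ih,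
      Finsupp.sum_single_index (by simp)]
    simp [periodicExt]

lemma isSolution_countVector {f : ℝ} (L : List ℝ) (h : L.sum = f) :
    IsSolution f (countVector L) := by
  subst h
  induction L with
  | nil => exact ⟨0, by simp [countVector]⟩
  | cons x L ih =>
    obtain ⟨k, hk⟩ := ih
    refine ⟨k - ⌊x⌋, ?_⟩
    simp only [countVector, List.map_cons, List.sum_cons] at hk ⊢
    rw [Finsupp.sum_add_index' (by simp) (by intros; push_cast; ring), hk,
      Finsupp.sum_single_index (by simp)]
    push_cast
    linarith [Int.self_sub_floor x]

lemma sum_periodicExt_eq_one {f : ℝ} {π π' : UnitIco → ℝ}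
    (hP : tightSolutions f π ⊆ tightSolutions f π') (L : List ℝ) (hL : L.sum = f)
    (h : (L.map (periodicExt π)).sum = 1) : (L.map (periodicExt π')).sum = 1 := by
  rw [← lhs_countVector] at h ⊢
  exact (hP ⟨isSolution_countVector L hL, h⟩).2

/-- A bounded function that is additive on `[0,L]` is linear there. -/
lemma linear_of_bounded_additive {h : ℝ → ℝ} {L C : ℝ} (hL : 0 < L) (hC : ∀ x, |h x| ≤ C)
    (hadd : ∀ x y, 0 ≤ x → 0 ≤ y → x + y ≤ L → h (x + y) = h x + h y) :
    ∀ x, 0 ≤ x → x ≤ L → h x = h L / L * x := by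
  have key : ∀ n : ℕ, ∀ x, 0 ≤ x → x ≤ L → |h x - h L / L * x| ≤ 2 * C / 2 ^ n := by
    intro n
    induction n with
    | zero =>
      intro x hx hxL
      have h1 : |h L / L * x| ≤ C := by
        rw [abs_mul, abs_div, abs_of_pos hL, abs_of_nonneg hx, div_mul_eq_mul_div, div_le_iff₀ hL]
        exact mul_le_mul (hC L) hxL hx ((abs_nonneg _).trans (hC L))
      calc _ ≤ |h x| + |h L / L * x| := abs_sub _ _
        _ ≤ _ := by rw [pow_zero, div_one]; linarith [hC x]
    | succ n ih =>
      -- Doubling `x` doubles the deviation from linearity, so the bound halves on `[0, L/2]`; the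
      -- deviation is odd under `x ↦ L - x`, which covers the other half.
      have half : ∀ x, 0 ≤ x → x + x ≤ L → |h x - h L / L * x| ≤ 2 * C / 2 ^ (n + 1) := by
        intro x hx hxL
        have h1 := ih (x + x) (by linarith) hxL
        rw [hadd x x hx hx hxL, show h x + h x - h L / L * (x + x) = 2 * (h x - h L / L * x) by ring,
          abs_mul, abs_two] at h1
        rw [pow_succ, ← div_div, le_div_iff₀ two_pos]
        linarith
      intro x hx hxL
      rcases le_total (x + x) L with h1 | h1
      · exact half x hx h1
      · have h2 := half (L - x) (by linarith) (by linarith)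
        have h3 := hadd x (L - x) hx (by linarith) (by linarith)
        rw [add_sub_cancel] at h3
        rw [← abs_neg]
        convert h2 using 2
        have h4 : h L / L * L = h L := div_mul_cancel₀ _ hL.ne'
        rw [mul_sub, h4]
        linarith
  intro x hx hxL
  rw [← sub_eq_zero, ← abs_nonpos_iff]
  have hlim : Filter.Tendsto (fun n : ℕ => 2 * C / 2 ^ n) Filter.atTop (nhds 0) := by
    have := (tendsto_pow_atTop_nhds_zero_of_lt_one (r := (1 / 2 : ℝ)) (by norm_num)
      (by norm_num)).const_mul (2 * C)
    simpa [div_eq_mul_inv] using this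
  exact ge_of_tendsto' hlim fun n => key n x hx hxL

variable {α : ℝ} {ε : ℕ → ℝ} {i : ℕ}

/-- A bounded periodic function that is additive wherever `ψ_i` is vanishes on `[0,1]`. -/
lemma HasCantorShape.eq_zero_of_additive {q D : ℝ → ℝ} {C : ℝ} (H : IsAdmissible α ε)
    (S : HasCantorShape α ε i q) (hqper : ∀ x, q (x + 1) = q x) (hDper : ∀ x, D (x + 1) = D x)
    (hC : ∀ x, |D x| ≤ C) (hD0 : D 0 = 0) (hDα : D α = 0)
    (hadd : ∀ x y, q (x + y) = q x + q y → D (x + y) = D x + D y) :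
    ∀ x, 0 ≤ x → x ≤ 1 → D x = 0 := by
  have hl := H.length_pos i
  have hα : 0 < 1 - α := by linarith [H.lt_one]
  have hqneg : ∀ u, 0 ≤ u → u ≤ 1 - α → q (-u) = u / (1 - α) := by
    intro u hu hu'
    rw [← hqper, S.map_of_alpha_le (by linarith) (by linarith)]
    congr 1
    ring
  have hneg : ∀ u, 0 ≤ u → u ≤ 1 - α → D (-u) = 0 := by
    intro u hu hu'
    rw [linear_of_bounded_additive (h := fun u => D (-u)) hα (fun u => hC (-u)) ?_ u hu hu',
      ← hDper (-(1 - α))]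
    -- The linear function vanishes because its value at `1 - α` is `D (α - 1) = D α = 0`.
    · simp [hDα]
    · intro x y hx hy hxy
      rw [neg_add]
      refine hadd _ _ ?_
      rw [← neg_add, hqneg _ (by linarith) hxy, hqneg _ hx (by linarith), hqneg _ hy (by linarith)]
      ring
  have hqpos : ∀ u, 0 ≤ u → u ≤ pieceLength α ε i →
      q u = cantorForm α (u / pieceLength α ε i / 2 ^ i) u := by
    intro u hu hu'
    rw [S.inc 0 (by positivity) u (by rwa [leftEnd_zero]) (by rwa [leftEnd_zero, zero_add]),
      leftEnd_zero]
    simp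
  obtain ⟨d, hd⟩ : ∃ d, ∀ u, 0 ≤ u → u ≤ pieceLength α ε i → D u = d * u := by
    refine ⟨_, linear_of_bounded_additive hl hC fun x y hx hy hxy => hadd _ _ ?_⟩
    rw [hqpos _ (by linarith) hxy, hqpos _ hx (by linarith), hqpos _ hy (by linarith)]
    simp only [cantorForm]
    ring
  have hinc : ∀ k < 2 ^ i, ∀ x, leftEnd α ε i k ≤ x → x ≤ leftEnd α ε i k + pieceLength α ε i →
      D x = D (leftEnd α ε i k) + d * (x - leftEnd α ε i k) := by
    intro k hk x hx hx'
    rw [← hd (x - leftEnd α ε i k) (by linarith) (by linarith), ← hadd, add_sub_cancel]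
    rw [add_sub_cancel, S.inc k hk x hx hx', S.inc k hk _ le_rfl (by linarith),
      hqpos _ (by linarith) (by linarith)]
    simp only [cantorForm]
    ring
  have hdec : ∀ k < 2 ^ i, ∀ x, leftEnd α ε i k + pieceLength α ε i ≤ x →
      x ≤ leftEnd α ε i (k + 1) → D x = D (leftEnd α ε i (k + 1)) := by
    intro k hk x hx hx'
    have h1 := leftEnd_succ_le H i k
    have h2 := hneg (leftEnd α ε i (k + 1) - x) (by linarith) (by linarith)
    have h3 : leftEnd α ε i (k + 1) + -(leftEnd α ε i (k + 1) - x) = x := by ring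
    have h4 := hadd (leftEnd α ε i (k + 1)) (-(leftEnd α ε i (k + 1) - x)) (by
      rw [h3, hqneg _ (by linarith) (by linarith), S.dec k hk x hx hx',
        S.dec k hk _ (by linarith) le_rfl]
      simp only [cantorForm]
      ring)
    rw [h3, h2, add_zero] at h4
    exact h4
  have hvals : ∀ k ≤ 2 ^ i, D (leftEnd α ε i k) = k * (d * pieceLength α ε i) := by
    intro k
    induction k with
    | zero => simp [leftEnd_zero, hD0]
    | succ k ih =>
      intro hk
      rw [← hdec k hk _ le_rfl (by linarith [leftEnd_succ_ge H i k, H.eps_pos i]),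
        hinc k hk _ (by linarith) le_rfl, ih (by omega)]
      push_cast
      ring
  have hd0 : d = 0 := by
    -- After one full period the accumulated increase `2 ^ i * (d * l)` must equal `D 1 = D 0 = 0`.
    have h1 := hvals (2 ^ i) le_rfl
    rw [leftEnd_two_pow, ← zero_add (1 : ℝ), hDper, hD0] at h1
    have h2 : ((2 ^ i : ℕ) : ℝ) ≠ 0 := by positivity
    simpa [hl.ne'] using h1.symm
  subst hd0
  simp only [zero_mul, mul_zero, add_zero] at hinc hvals
  intro x hx hx1
  obtain ⟨k, hk, h1, h2⟩ := exists_leftEnd_mem_unit (α := α) (ε := ε) i hx hx1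
  rcases le_total x (leftEnd α ε i k + pieceLength α ε i) with h3 | h3
  · rw [hinc k hk x h1 h3, hvals k hk.le]
  · rw [hdec k hk x h3 h2, hvals (k + 1) hk]

lemma HasCantorShape.congr {g q : ℝ → ℝ} (H : IsAdmissible α ε) (S : HasCantorShape α ε i g)
    (h : ∀ x, 0 ≤ x → x ≤ 1 → q x = g x) : HasCantorShape α ε i q := by
  have hl := H.length_pos i
  constructor
  · intro k hk x hx hx'
    rw [h x ((leftEnd_nonneg H i k).trans hx)
      (by linarith [leftEnd_add_length_le_alpha H hk, H.lt_one]), S.inc k hk x hx hx']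
  · intro k hk x hx hx'
    have h1 := leftEnd_nonneg H i k
    have h2 : leftEnd α ε i (k + 1) ≤ 1 := by
      rcases Nat.lt_or_eq_of_le (Nat.succ_le_of_lt hk) with h2 | h2
      · have h3 := leftEnd_add_length_le_alpha H h2
        rw [Nat.succ_eq_add_one] at h3
        linarith [H.lt_one]
      · rw [Nat.succ_eq_add_one] at h2
        rw [h2, leftEnd_two_pow]
    rw [h x (by linarith) (by linarith), S.dec k hk x hx hx']

lemma periodicExt_psi (H : IsAdmissible α ε) {x : ℝ} (hx : 0 ≤ x) (hx1 : x ≤ 1) :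
    periodicExt (psi α ε i) x = psiReal α ε i x := by
  have S := psiReal_hasCantorShape H i
  rcases hx1.lt_or_eq with hx1 | rfl
  · exact periodicExt_of_mem (psi α ε i) ⟨x, hx, hx1⟩
  · rw [S.map_of_alpha_le H.lt_one.le le_rfl, ← zero_add (1 : ℝ), periodicExt_add_one]
    have := periodicExt_of_mem (psi α ε i) ⟨0, le_rfl, one_pos⟩
    simpa [psi, S.map_zero H] using this

/-- Makes the pair `x, α - x` a tight solution for every real `x`, with points taken modulo 1. -/
lemma periodicExt_psi_add_symm (H : IsAdmissible α ε) (x : ℝ) :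
    periodicExt (psi α ε i) x + periodicExt (psi α ε i) (α - x) = 1 := by
  have S := psiReal_hasCantorShape H i
  have hα : 1 - α ≠ 0 := by linarith [H.lt_one]
  have h0 := Int.fract_nonneg x
  have h1 := Int.fract_lt_one x
  have hfr : ∀ (π : UnitIco → ℝ) (y z : ℝ), Int.fract y = Int.fract z →
      periodicExt π y = periodicExt π z := fun π y z h => by simp only [periodicExt, h]
  rw [hfr _ x (Int.fract x) (by simp), hfr _ (α - x) (α - Int.fract x)
    (Int.fract_eq_fract.2 ⟨-⌊x⌋, by rw [Int.fract]; push_cast; ring⟩), periodicExt_psi H h0 h1.le]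
  rcases le_total (Int.fract x) α with h | h
  · rw [periodicExt_psi H (by linarith) (by linarith [H.lt_one]), S.add_symm H h0 h]
  · rw [← periodicExt_add_one, periodicExt_psi H (by linarith [H.pos]) (by linarith),
      S.map_of_alpha_le h h1.le, S.map_of_alpha_le (by linarith) (by linarith)]
    field_simp
    ring

lemma psi_isFacet (H : IsAdmissible α ε) (i : ℕ) : IsFacet α (psi α ε i) := by
  refine ⟨psi_isValid H i, fun π' hV hP => ?_⟩
  set q := periodicExt (psi α ε i) with hq
  set p := periodicExt π' with hp
  have S : HasCantorShape α ε i q := (psiReal_hasCantorShape H i).congr H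
    fun x hx hx1 => periodicExt_psi H hx hx1
  have hqsymm : ∀ x, q x + q (α - x) = 1 := periodicExt_psi_add_symm H
  have hpsymm : ∀ x, p x + p (α - x) = 1 := fun x => by
    simpa using sum_periodicExt_eq_one hP [x, α - x] (by simp) (by simpa using hqsymm x)
  have hq0 : ∀ x, 0 ≤ q x := fun x => (psi_isValid H i).nonneg _
  have hp0 : ∀ x, 0 ≤ p x := fun x => hV.nonneg _
  have hpz : p 0 = 0 := by
    rw [hp, periodicExt_of_mem π' ⟨0, le_rfl, one_pos⟩]
    exact hV.map_zero
  have hqz : q 0 = 0 := S.map_zero H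
  have hadd : ∀ x y, q (x + y) = q x + q y → p (x + y) = p x + p y := by
    intro x y hxy
    -- By symmetry, additivity at `x, y` says exactly that `x, y, α - (x + y)` is a tight solution.
    have h1 := sum_periodicExt_eq_one hP [x, y, α - (x + y)]
      (by simp only [List.sum_cons, List.sum_nil]; ring) (by
        simp only [List.map_cons, List.map_nil, List.sum_cons, List.sum_nil]
        linarith [hqsymm (x + y)])
    simp only [List.map_cons, List.map_nil, List.sum_cons, List.sum_nil] at h1
    linarith [hpsymm (x + y)]
  have hD := S.eq_zero_of_additive (D := fun x => p x - q x) (C := 1) H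
    (periodicExt_add_one _) (fun x => by simp only [hp, hq, periodicExt_add_one])
    -- Nonnegativity and symmetry confine both functions to `[0, 1]`, which gives the bound `1`.
    (fun x => abs_le.2 ⟨by linarith [hp0 x, hq0 (α - x), hqsymm x],
      by linarith [hq0 x, hp0 (α - x), hpsymm x]⟩)
    (by simp [hpz, hqz])
    (by
      have h1 := hpsymm 0
      have h2 := hqsymm 0
      rw [sub_zero] at h1 h2
      linarith)
    (fun x y h => by linarith [hadd x y h])
  funext r
  have h1 := hD r r.2.1 r.2.2.le
  rw [← periodicExt_of_mem π' r, ← periodicExt_of_mem (psi α ε i) r]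
  linarith

end Facet

theorem mainTheorem2 (α : ℝ) (hα₀ : 0 < α) (hα₁ : α < 1)
    (ε : ℕ → ℝ) (hpos : ∀ i, 1 ≤ i → 0 < ε i)
    (hmono : ∀ i, 1 ≤ i → ε (i + 1) ≤ ε i)
    (hε₁ : ε 1 ≤ 1 - α)
    (hsum : Summable fun i : ℕ => (2 : ℝ) ^ i * ε (i + 1))
    (hlt : ∑' i : ℕ, (2 : ℝ) ^ i * ε (i + 1) < α)
    (i : ℕ) :
    IsFacet α (psi α ε i) := by
  have heps : ∀ j, 0 < ε (j + 1) := fun j => hpos (j + 1) (by omega)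
  refine psi_isFacet ⟨hα₀, hα₁, heps, fun j => ?_, fun j => hmono (j + 1) (by omega), fun j => ?_⟩ i
  · induction j with
    | zero => exact hε₁
    | succ j ih => exact (hmono (j + 1) (by omega)).trans ih
  -- The total length `2 ^ j * l` left at level `j` is `α` minus a partial sum of the series, hence
  -- positive.
  · have h1 := hsum.sum_le_tsum (Finset.range j)
      fun k _ => mul_nonneg (by positivity) (heps k).le
    have h2 := two_pow_mul_pieceLength (α := α) (ε := ε) j
    exact pos_of_mul_pos_right (by linarith : 0 < (2 : ℝ) ^ j * pieceLength α ε j) (by positivity)
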